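/- Let $\kappa\in\mathbb R$, $\kappa\neq 0$. For functions $F,f$ on $\mathbb C=\mathbb R^2$ with $f$ Schwartz and $F$ measurable of polynomial growth, let $$(F\star f)(w)=\Big(\frac{2}{\pi\kappa}\Big)^2\int_{\mathbb C}d^2s\int_{\mathbb C}d^2t\;F(w+s)\,f(w+t)\,e^{-\frac{4i}{\kappa}\operatorname{Im}(s^*t)}$$ be the Moyal product (iterated integral). Left Moyal multiplications by the coordinate functions $z$ and $z^*$ are operators on $\mathcal S(\mathbb R^2)$, again denoted $z$, $z^*$ (they satisfy $z^*z-zz^*=\kappa$); put $a=zz^*$, $b=z^2$, $b^*=(z^*)^2$ (products of operators), acting diagonally on $\mathcal S(\mathbb R^2)\otimes\mathbb C^2\subset L^2(\mathbb R^2)\otimes\mathbb C^2$. Let $$D=\begin{pmatrix}0&\partial_z\\ \partial_{z^*}&0\end{pmatrix},\qquad \gamma=\begin{pmatrix}1&0\\0&-1\end{pmatrix},\qquad \rho(\psi_1,\psi_2)(z)=(\psi_1(-z),-\psi_2(-z)),$$ where $\partial_z=\frac12(\partial_x-i\partial_y)$ and $\partial_{z^*}=\frac12(\partial_x+i\partial_y)$.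 The operators $D,\gamma,a,b,b^*$ commute with the $\mathbb Z_2$-action $\rho$. For $\varepsilon=\pm1$ let $\mathcal H_\varepsilon$ be the $\varepsilon$-eigenspace of $\rho$ in $L^2(\mathbb R^2)\otimes\mathbb C^2$ (the Hilbert space of the restricted spectral triple of the $\mathbb Z_2$ Moyal cone), and $\mathcal S_\varepsilon$ the $\varepsilon$-eigenspace of $\rho$ in $\mathcal S(\mathbb R^2)\otimes\mathbb C^2$. Then $\mathcal S_\varepsilon$ is dense in $\mathcal H_\varepsilon$, and on $\mathcal S_\varepsilon$ the following identity of operators holds: $$-[D,b^*]a[D,b]-2a[D,b][D,b^*]+\tfrac32a[D,b^*][D,b]+3b[D,a][D,b^*]-b[D,b^*][D,a]+b^*[D,b][D,a]=4\kappa^2\gamma.$$ -/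

import Mathlib

open scoped SchwartzMap FourierTransform LineDeriv ComplexConjugate

noncomputable section

namespace MoyalCone

/-- The Moyal product on the plane `ℂ = ℝ²`, as an iterated oscillating integral, normalised so
that `z⋆ * z - z * z⋆ = κ` and `1 * f = f`:
`(F * f)(w) = (2 / (π κ))² ∫ d²s ∫ d²t F(w + s) f(w + t) exp(-(4 i / κ) Im(s⋆ t))`.
If `f` is a Schwartz function, the inner integral is a Schwartz function of `s`, so that `F` may
be any measurable function of polynomial growth. -/
def moyal (κ : ℝ) (F f : ℂ → ℂ) (w : ℂ) : ℂ :=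
  ((2 / (Real.pi * κ)) ^ 2 : ℝ) *
    ∫ s : ℂ, ∫ t : ℂ, F (w + s) * f (w + t) *
      Complex.exp (-(4 * Complex.I / κ) * ((conj s * t).im : ℝ))

theorem moyal_inner (κ : ℝ) (f : 𝓢(ℂ, ℂ)) (w s c : ℂ) :
    (∫ t : ℂ, c * f (w + t) * Complex.exp (-(4 * Complex.I / κ) * ((conj s * t).im : ℝ))) =
      c * (Complex.exp (((2 * Real.pi * inner ℝ ((2 / (Real.pi * κ)) • (Complex.I * s)) w : ℝ) : ℂ)
        * Complex.I) * (𝓕 f) ((2 / (Real.pi * κ)) • (Complex.I * s))) := by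
  rw [← MeasureTheory.integral_add_left_eq_self (μ := MeasureTheory.volume) _ (-w),
    SchwartzMap.fourier_coe, Real.fourier_eq', ← MeasureTheory.integral_const_mul,
    ← MeasureTheory.integral_const_mul]
  congr 1
  ext v
  rw [smul_eq_mul, ← mul_assoc (Complex.exp _), ← Complex.exp_add, add_neg_cancel_left, mul_assoc,
    mul_comm (f v)]
  congr 3
  simp only [Complex.inner, Complex.real_smul, map_mul, Complex.conj_ofReal, Complex.conj_I,
    Complex.mul_im, Complex.mul_re, Complex.ofReal_re, Complex.ofReal_im, Complex.I_re,
    Complex.I_im, Complex.conj_re, Complex.conj_im, Complex.add_re, Complex.add_im, Complex.neg_re,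
    Complex.neg_im]
  push_cast
  have := Complex.ofReal_ne_zero.2 Real.pi_ne_zero
  by_cases h : (κ : ℂ) = 0
  · simp [h]
  field_simp
  ring

theorem integral_I_mul (H : ℂ → ℂ) : ∫ x : ℂ, H (Complex.I * x) = ∫ x : ℂ, H x := by
  have h := (rotation ⟨Complex.I, by simp [Submonoid.unitSphere]⟩).measurePreserving
  exact h.integral_comp (rotation _).toHomeomorph.measurableEmbedding H

theorem moyal_linear {κ : ℝ} (hκ : κ ≠ 0) (F : ℂ →L[ℝ] ℂ) (f : 𝓢(ℂ, ℂ)) :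
    moyal κ F f = ⇑(SchwartzMap.smulLeftCLM ℂ F f + ((κ : ℂ) / (4 * Complex.I)) •
      (F 1 • ∂_{Complex.I} f - F Complex.I • ∂_{(1 : ℂ)} f)) := by
  have hF : (F : ℂ → ℂ).HasTemperateGrowth := F.hasTemperateGrowth
  have hpi := Complex.ofReal_ne_zero.2 Real.pi_ne_zero
  have hκ' : (κ : ℂ) ≠ 0 := by exact_mod_cast hκ
  ext w
  set g : 𝓢(ℂ, ℂ) := F w • f + ((κ : ℂ) / (4 * Complex.I)) •
      (F 1 • ∂_{Complex.I} f + (-F Complex.I) • ∂_{(1 : ℂ)} f) with hg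
  have hgw : (SchwartzMap.smulLeftCLM ℂ F f + ((κ : ℂ) / (4 * Complex.I)) •
      (F 1 • ∂_{Complex.I} f - F Complex.I • ∂_{(1 : ℂ)} f)) w = (𝓕⁻ (𝓕 g)) w := by
    rw [FourierTransform.fourierInv_fourier_eq, hg]
    simp [SchwartzMap.smulLeftCLM_apply_apply hF, sub_eq_add_neg]
  rw [hgw, SchwartzMap.fourierInv_coe, Real.fourierInv_eq', moyal]
  simp only [moyal_inner]
  set R : ℝ := 2 / (Real.pi * κ) with hR
  have hR0 : R ≠ 0 := by rw [hR]; have := Real.pi_ne_zero; positivity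
  set H : ℂ → ℂ := fun v => Complex.exp (((2 * Real.pi * inner ℝ v w : ℝ) : ℂ) * Complex.I) •
    (𝓕 g) v with hH
  have key : ∀ s : ℂ, F (w + s) * (Complex.exp (((2 * Real.pi *
      inner ℝ (R • (Complex.I * s)) w : ℝ) : ℂ) * Complex.I) * (𝓕 f) (R • (Complex.I * s))) =
      (fun x => H (Complex.I * x)) (R • s) := by
    intro s
    have hFs : F s = s.re * F 1 + s.im * F Complex.I := by
      conv_lhs => rw [← Complex.re_add_im s]
      have h1 := F.map_smul s.re 1
      have h2 := F.map_smul s.im Complex.I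
      simp only [Complex.real_smul, mul_one] at h1 h2
      rw [map_add, h1, h2]
    simp only [hH, hg, FourierTransform.fourier_add, FourierTransform.fourier_smul,
      SchwartzMap.fourier_lineDerivOp_eq]
    have e : Complex.I * R • s = R • (Complex.I * s) := by
      simp only [Complex.real_smul]; ring
    have t1 : ∀ m : ℂ, (fun x : ℂ => (inner ℝ x m : ℝ)).HasTemperateGrowth := by
      intro m; fun_prop
    rw [e]
    simp only [add_apply, smul_apply,
      SchwartzMap.smulLeftCLM_apply_apply (t1 _), map_add, hFs, smul_eq_mul]
    generalize (𝓕 f) (R • (Complex.I * s)) = q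
    simp only [Complex.inner, Complex.real_smul, map_mul, Complex.conj_ofReal, Complex.conj_I,
      Complex.mul_im, Complex.mul_re, Complex.ofReal_re, Complex.ofReal_im, Complex.I_re,
      Complex.I_im, Complex.conj_re, Complex.conj_im, Complex.neg_re, Complex.neg_im,
      Complex.one_re, Complex.one_im]
    generalize Complex.exp _ = E
    rw [hR]
    push_cast
    have := Complex.I_sq
    field_simp
    ring
  rw [MeasureTheory.integral_congr_ae (Filter.Eventually.of_forall key)]
  have h1 := MeasureTheory.Measure.integral_comp_smul (MeasureTheory.volume : MeasureTheory.Measure ℂ)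
    (fun x => H (Complex.I * x)) R
  rw [integral_I_mul, Complex.finrank_real_complex, abs_of_nonneg (by positivity),
    Complex.real_smul] at h1
  refine (congrArg (fun x => ((R ^ 2 : ℝ) : ℂ) * x) h1).trans ?_
  rw [← mul_assoc, ← Complex.ofReal_mul, mul_inv_cancel₀ (by positivity), Complex.ofReal_one,
    one_mul]

/-- Left Moyal multiplication `f ↦ F * f` by a real-linear function `F : ℂ → ℂ`, as an operator on
the Schwartz space. -/
def leftMul (κ : ℝ) (hκ : κ ≠ 0) (F : ℂ →L[ℝ] ℂ) : Module.End ℂ 𝓢(ℂ, ℂ) where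
  toFun f :=
    { toFun := moyal κ F f
      smooth' := by rw [moyal_linear hκ]; exact SchwartzMap.smooth' _
      decay' := by rw [moyal_linear hκ]; exact SchwartzMap.decay' _ }
  map_add' f g := by
    apply DFunLike.coe_injective
    change moyal κ F ⇑(f + g) = moyal κ F f + moyal κ F g
    simp only [moyal_linear hκ]
    ext w
    simp [LineDeriv.lineDerivOp_add]
    ring
  map_smul' c f := by
    apply DFunLike.coe_injective
    change moyal κ F ⇑(c • f) = c • moyal κ F f
    simp only [moyal_linear hκ]
    ext w
    simp [LineDeriv.lineDerivOp_smul]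
    ring

/-- The coordinate `z` of the Moyal plane, acting by left Moyal multiplication. -/
def coordZ (κ : ℝ) (hκ : κ ≠ 0) : Module.End ℂ 𝓢(ℂ, ℂ) :=
  leftMul κ hκ (ContinuousLinearMap.id ℝ ℂ)

/-- The conjugate coordinate `z⋆` of the Moyal plane, acting by left Moyal multiplication. -/
def coordZStar (κ : ℝ) (hκ : κ ≠ 0) : Module.End ℂ 𝓢(ℂ, ℂ) :=
  leftMul κ hκ (Complex.conjCLE : ℂ →L[ℝ] ℂ)

/-- `∂_z = (∂_x - i ∂_y) / 2`. -/
def delZ : Module.End ℂ 𝓢(ℂ, ℂ) :=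
  (1 / 2 : ℂ) • ((LineDeriv.lineDerivOpCLM ℂ 𝓢(ℂ, ℂ) (1 : ℂ)).toLinearMap -
    Complex.I • (LineDeriv.lineDerivOpCLM ℂ 𝓢(ℂ, ℂ) Complex.I).toLinearMap)

/-- `∂_{z⋆} = (∂_x + i ∂_y) / 2`. -/
def delZStar : Module.End ℂ 𝓢(ℂ, ℂ) :=
  (1 / 2 : ℂ) • ((LineDeriv.lineDerivOpCLM ℂ 𝓢(ℂ, ℂ) (1 : ℂ)).toLinearMap +
    Complex.I • (LineDeriv.lineDerivOpCLM ℂ 𝓢(ℂ, ℂ) Complex.I).toLinearMap)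

/-- The action of the generator of `ℤ₂` on functions, `σ(f)(z) = f(e^{πi} z) = f(-z)`. -/
def sigma : Module.End ℂ 𝓢(ℂ, ℂ) :=
  (SchwartzMap.compCLMOfContinuousLinearEquiv ℂ (ContinuousLinearEquiv.neg ℝ)).toLinearMap

/-- Schwartz spinors `𝓢(ℝ²) ⊗ ℂ²`. -/
abbrev Spinor : Type := 𝓢(ℂ, ℂ) × 𝓢(ℂ, ℂ)

/-- The Dirac operator `D = (0, ∂_z; ∂_{z⋆}, 0)`. -/
def diracPlane : Module.End ℂ Spinor :=
  (delZ ∘ₗ LinearMap.snd ℂ _ _).prod (delZStar ∘ₗ LinearMap.fst ℂ _ _)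

/-- The chirality operator `γ = (1, 0; 0, -1)`. -/
def chiralityPlane : Module.End ℂ Spinor := LinearMap.prodMap 1 (-1)

/-- The diagonal action on spinors of an operator on functions. -/
def diag (T : Module.End ℂ 𝓢(ℂ, ℂ)) : Module.End ℂ Spinor := LinearMap.prodMap T T

/-- The lift of the `ℤ₂`-action to spinors, unique up to a sign, that commutes with `D` and `γ` and
implements `σ`. -/
def rho : Module.End ℂ Spinor := LinearMap.prodMap sigma (-sigma)

/-- The Schwartz spinors in the eigenspace of `ρ` with eigenvalue `ε`. For `ε = ±1` these are the
common dense domain of the operators of the spectral triple of the Moyal cone. -/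
def core (ε : ℂ) : Submodule ℂ Spinor := Module.End.eigenspace rho ε

/-- The restriction to `core ε` of an operator on spinors that commutes with the `ℤ₂`-action. -/
def onCore (ε : ℂ) (T : Module.End ℂ Spinor) (hT : Commute T rho) : Module.End ℂ (core ε) :=
  T.restrict fun ψ hψ => by
    rw [core, Module.End.mem_eigenspace_iff] at hψ ⊢
    have h := LinearMap.congr_fun hT.eq ψ
    simp only [Module.End.mul_apply] at h
    rw [← h, hψ, map_smul]

theorem lineDeriv_sigma (m : ℂ) (f : 𝓢(ℂ, ℂ)) : ∂_{m} (sigma f) = -sigma (∂_{m} f) := by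
  refine (SchwartzMap.lineDerivOp_compCLMOfContinuousLinearEquiv ℂ m
    (ContinuousLinearEquiv.neg ℝ) f).trans ?_
  ext w
  simp [sigma, SchwartzMap.lineDerivOp_apply_eq_fderiv]

theorem leftMul_sigma (κ : ℝ) (hκ : κ ≠ 0) (F : ℂ →L[ℝ] ℂ) :
    leftMul κ hκ F * sigma = -(sigma * leftMul κ hκ F) := by
  have hF : (F : ℂ → ℂ).HasTemperateGrowth := F.hasTemperateGrowth
  ext f w
  change moyal κ F (sigma f) w = -moyal κ F f (-w)
  simp only [moyal_linear hκ, lineDeriv_sigma]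
  simp [SchwartzMap.smulLeftCLM_apply_apply hF, sigma]
  ring

theorem diag_commute (κ : ℝ) (hκ : κ ≠ 0) (F G : ℂ →L[ℝ] ℂ) :
    Commute (diag (leftMul κ hκ F * leftMul κ hκ G)) rho := by
  have h : leftMul κ hκ F * leftMul κ hκ G * sigma = sigma * (leftMul κ hκ F * leftMul κ hκ G) := by
    rw [mul_assoc, leftMul_sigma, mul_neg, ← mul_assoc, leftMul_sigma]
    simp [mul_assoc]
  have h' := fun f => LinearMap.congr_fun h f
  simp only [Module.End.mul_apply] at h'
  refine LinearMap.ext fun ψ => Prod.ext ?_ ?_ <;> simp [diag, rho, h']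

theorem dirac_commute : Commute diracPlane rho := by
  refine LinearMap.ext fun ψ => Prod.ext ?_ ?_ <;>
  simp [diracPlane, rho, delZ, delZStar, lineDeriv_sigma] <;> module

theorem chirality_commute : Commute chiralityPlane rho := by
  refine LinearMap.ext fun ψ => Prod.ext ?_ ?_ <;> simp [chiralityPlane, rho]

/-- The Dirac operator of the Moyal cone. -/
def dirac (ε : ℂ) : Module.End ℂ (core ε) := onCore ε diracPlane dirac_commute

/-- The chirality operator of the Moyal cone. -/
def chirality (ε : ℂ) : Module.End ℂ (core ε) := onCore ε chiralityPlane chirality_commute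

/-- The generator `a = z z⋆` of the cone algebra, acting on spinors. -/
def genA (κ : ℝ) (hκ : κ ≠ 0) (ε : ℂ) : Module.End ℂ (core ε) :=
  onCore ε (diag (coordZ κ hκ * coordZStar κ hκ)) (diag_commute κ hκ _ _)

/-- The generator `b = z²` of the cone algebra, acting on spinors. -/
def genB (κ : ℝ) (hκ : κ ≠ 0) (ε : ℂ) : Module.End ℂ (core ε) :=
  onCore ε (diag (coordZ κ hκ * coordZ κ hκ)) (diag_commute κ hκ _ _)

/-- The generator `b⋆ = (z⋆)²` of the cone algebra, acting on spinors. -/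
def genBStar (κ : ℝ) (hκ : κ ≠ 0) (ε : ℂ) : Module.End ℂ (core ε) :=
  onCore ε (diag (coordZStar κ hκ * coordZStar κ hκ)) (diag_commute κ hκ _ _)

/-- `L²(ℝ²)`. -/
abbrev L2 : Type := MeasureTheory.Lp ℂ 2 (MeasureTheory.volume : MeasureTheory.Measure ℂ)

/-- The Hilbert space `L²(ℝ²) ⊗ ℂ²` of the Moyal plane. -/
abbrev HilbertPlane : Type := WithLp 2 (L2 × L2)

/-- The action of the generator of `ℤ₂` on `L²(ℝ²)`, `f(z) ↦ f(-z)`. -/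
def sigmaL2 : L2 →ₗ[ℂ] L2 :=
  (MeasureTheory.Lp.compMeasurePreservingₗᵢ ℂ Neg.neg
    (MeasureTheory.Measure.measurePreserving_neg MeasureTheory.volume)).toLinearMap

/-- The lift of the `ℤ₂`-action to the Hilbert space. -/
def rhoL2 : Module.End ℂ HilbertPlane :=
  (WithLp.linearEquiv 2 ℂ (L2 × L2)).symm.toLinearMap ∘ₗ
    LinearMap.prodMap sigmaL2 (-sigmaL2) ∘ₗ (WithLp.linearEquiv 2 ℂ (L2 × L2)).toLinearMap

/-- The Hilbert space of the Moyal cone: the eigenspace of `ρ` with eigenvalue `ε = ±1`. -/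
def hilbert (ε : ℂ) : Submodule ℂ HilbertPlane := Module.End.eigenspace rhoL2 ε

/-- The inclusion of Schwartz spinors into the Hilbert space. -/
def toHilbert : Spinor →ₗ[ℂ] HilbertPlane :=
  (WithLp.linearEquiv 2 ℂ (L2 × L2)).symm.toLinearMap ∘ₗ
    LinearMap.prodMap (SchwartzMap.toLpCLM ℂ ℂ 2 MeasureTheory.volume).toLinearMap
      (SchwartzMap.toLpCLM ℂ ℂ 2 MeasureTheory.volume).toLinearMap

end MoyalCone

end

open MoyalCone

namespace MoyalCone

/-! By `moyal_linear`, `z` acts as pointwise multiplication by `z` minus `(κ/2) ∂_{z⋆}`, and `z⋆` as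
multiplication by its conjugate plus `(κ/2) ∂_z`. Hence `∂_z` and `∂_{z⋆}` obey the Leibniz rule for
these operators, and `[D,a]`, `[D,b]`, `[D,b⋆]` are off-diagonal with entries linear in `z`, `z⋆`.

Every term of the identity is therefore diagonal. With `N = z z⋆` and `z⋆ z = N + κ`, the upper
entry is `-8N² + 6(N² - κN) + 2(N² + 3κN + 2κ²) = 4κ²`, and the lower one is `-4(N + κ)² + 6N(N + κ)
- 2(N² - κN) = -4κ²`.

Density is independent of this: the averaging operator `(1 + ερ)/2` is continuous, maps Schwartz
spinors into `core ε` and fixes `hilbert ε`. -/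

/-! ### Leibniz rules and the commutation relation. -/

theorem leftMul_apply (κ : ℝ) (hκ : κ ≠ 0) (F : ℂ →L[ℝ] ℂ) (f : 𝓢(ℂ, ℂ)) :
    leftMul κ hκ F f = SchwartzMap.smulLeftCLM ℂ F f + ((κ : ℂ) / (4 * Complex.I)) •
      (F 1 • ∂_{Complex.I} f - F Complex.I • ∂_{(1 : ℂ)} f) :=
  DFunLike.coe_injective (moyal_linear hκ F f)

/-- The Leibniz rule for the multiplication of a Schwartz function by a linear function. -/
theorem lineDeriv_smulLeft (F : ℂ →L[ℝ] ℂ) (m : ℂ) (f : 𝓢(ℂ, ℂ)) :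
    ∂_{m} (SchwartzMap.smulLeftCLM ℂ F f) =
      SchwartzMap.smulLeftCLM ℂ F (∂_{m} f) + F m • f := by
  have hF : (F : ℂ → ℂ).HasTemperateGrowth := F.hasTemperateGrowth
  ext w
  have e : ⇑(SchwartzMap.smulLeftCLM ℂ F f) = fun x => F x * f x := by
    ext x; simp [SchwartzMap.smulLeftCLM_apply_apply hF]
  have h := (F.hasFDerivAt (x := w)).mul (f.differentiableAt (x := w)).hasFDerivAt
  rw [SchwartzMap.lineDerivOp_apply_eq_fderiv, e]
  simp only [add_apply, smul_apply, SchwartzMap.smulLeftCLM_apply_apply hF,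
    SchwartzMap.lineDerivOp_apply_eq_fderiv]
  refine (congrArg (fun L : ℂ →L[ℝ] ℂ => L m) h.fderiv).trans ?_
  simp [mul_comm]

/-- Both sides are values of the second Fréchet derivative, which is symmetric for a smooth
function. -/
theorem lineDeriv_comm (m n : ℂ) (f : 𝓢(ℂ, ℂ)) : ∂_{m} (∂_{n} f) = ∂_{n} (∂_{m} f) := by
  have h : ∀ m n w : ℂ, (∂_{m} (∂_{n} f)) w = fderiv ℝ (fderiv ℝ f) w m n := by
    intro m n w
    have hf : DifferentiableAt ℝ (fderiv ℝ f) w :=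
      ((f.smooth 2).contDiffAt.fderiv_right (m := 1) (by norm_num)).differentiableAt (by norm_num)
    have e : ⇑(∂_{n} f : 𝓢(ℂ, ℂ)) = fun x => fderiv ℝ f x n :=
      funext (SchwartzMap.lineDerivOp_apply_eq_fderiv n f)
    rw [SchwartzMap.lineDerivOp_apply_eq_fderiv, e, fderiv_clm_apply hf (by fun_prop)]
    simp
  ext w
  rw [h, h]
  exact (f.smooth 2).contDiffAt.isSymmSndFDerivAt (by simp) m n

/-- Left Moyal multiplication by a linear function satisfies the Leibniz rule. -/
theorem lineDeriv_leftMul (κ : ℝ) (hκ : κ ≠ 0) (F : ℂ →L[ℝ] ℂ) (m : ℂ) (f : 𝓢(ℂ, ℂ)) :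
    ∂_{m} (leftMul κ hκ F f) = leftMul κ hκ F (∂_{m} f) + F m • f := by
  simp only [leftMul_apply, LineDeriv.lineDerivOp_add, LineDeriv.lineDerivOp_smul,
    LineDeriv.lineDerivOp_neg, sub_eq_add_neg, lineDeriv_smulLeft]
  -- The first-order part of the Moyal multiplication has constant coefficients, so `∂_m` passes
  -- through it.
  rw [lineDeriv_comm m Complex.I, lineDeriv_comm m 1]
  abel

/-- In this and the next three lemmas the extra term is the Wirtinger derivative `(F 1 ∓ i F(i))/2`
of the symbol `F`, equal to 1 or 0 because `i² = -1`. -/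
theorem delZ_coordZ (κ : ℝ) (hκ : κ ≠ 0) (f : 𝓢(ℂ, ℂ)) :
    delZ (coordZ κ hκ f) = coordZ κ hκ (delZ f) + f := by
  ext w
  simp [delZ, coordZ, lineDeriv_leftMul]
  linear_combination (-(1 / 2) * f w) * Complex.I_sq

theorem delZ_coordZStar (κ : ℝ) (hκ : κ ≠ 0) (f : 𝓢(ℂ, ℂ)) :
    delZ (coordZStar κ hκ f) = coordZStar κ hκ (delZ f) := by
  ext w
  simp [delZ, coordZStar, lineDeriv_leftMul]
  linear_combination f w * Complex.I_sq

theorem delZStar_coordZ (κ : ℝ) (hκ : κ ≠ 0) (f : 𝓢(ℂ, ℂ)) :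
    delZStar (coordZ κ hκ f) = coordZ κ hκ (delZStar f) := by
  ext w
  simp [delZStar, coordZ, lineDeriv_leftMul]
  linear_combination ((1 / 2) * f w) * Complex.I_sq

theorem delZStar_coordZStar (κ : ℝ) (hκ : κ ≠ 0) (f : 𝓢(ℂ, ℂ)) :
    delZStar (coordZStar κ hκ f) = coordZStar κ hκ (delZStar f) + f := by
  ext w
  simp [delZStar, coordZStar, lineDeriv_leftMul]
  linear_combination (-(1 / 2) * f w) * Complex.I_sq

/-- The commutation relation `z⋆ z - z z⋆ = κ`. -/
theorem coordZStar_coordZ (κ : ℝ) (hκ : κ ≠ 0) (f : 𝓢(ℂ, ℂ)) :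
    coordZStar κ hκ (coordZ κ hκ f) = coordZ κ hκ (coordZStar κ hκ f) + (κ : ℂ) • f := by
  have hF := (ContinuousLinearMap.id ℝ ℂ).hasTemperateGrowth
  have hG := (Complex.conjCLE : ℂ →L[ℝ] ℂ).hasTemperateGrowth
  ext w
  rw [coordZ, coordZStar, leftMul_apply κ hκ _ (leftMul κ hκ _ f), lineDeriv_leftMul,
    lineDeriv_leftMul]
  simp only [leftMul_apply, map_add, map_smul, map_sub, lineDeriv_smulLeft]
  -- The second-order terms cancel once the mixed derivatives are identified.
  rw [lineDeriv_comm Complex.I 1]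
  simp only [add_apply, sub_apply, smul_apply, smul_eq_mul,
    SchwartzMap.smulLeftCLM_apply_apply hF, SchwartzMap.smulLeftCLM_apply_apply hG]
  simp
  field_simp
  ring

/-! ### The orientability identity. -/

/-- The orientability identity of the Moyal cone, on the Schwartz spinors. -/
theorem orientation_identity (κ : ℝ) (hκ : κ ≠ 0) (ε : ℂ) :
    -(⁅dirac ε, genBStar κ hκ ε⁆ * genA κ hκ ε * ⁅dirac ε, genB κ hκ ε⁆)
        - (2 : ℂ) • (genA κ hκ ε * ⁅dirac ε, genB κ hκ ε⁆ * ⁅dirac ε, genBStar κ hκ ε⁆)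
        + (3 / 2 : ℂ) • (genA κ hκ ε * ⁅dirac ε, genBStar κ hκ ε⁆ * ⁅dirac ε, genB κ hκ ε⁆)
        + (3 : ℂ) • (genB κ hκ ε * ⁅dirac ε, genA κ hκ ε⁆ * ⁅dirac ε, genBStar κ hκ ε⁆)
        - genB κ hκ ε * ⁅dirac ε, genBStar κ hκ ε⁆ * ⁅dirac ε, genA κ hκ ε⁆
        + genBStar κ hκ ε * ⁅dirac ε, genB κ hκ ε⁆ * ⁅dirac ε, genA κ hκ ε⁆
        = (4 * (κ : ℂ) ^ 2) • chirality ε := by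
  have hA : ∀ ψ, ((genA κ hκ ε ψ : core ε) : Spinor) =
      (coordZ κ hκ (coordZStar κ hκ ψ.1.1), coordZ κ hκ (coordZStar κ hκ ψ.1.2)) := fun _ => rfl
  have hB : ∀ ψ, ((genB κ hκ ε ψ : core ε) : Spinor) =
      (coordZ κ hκ (coordZ κ hκ ψ.1.1), coordZ κ hκ (coordZ κ hκ ψ.1.2)) := fun _ => rfl
  have hBs : ∀ ψ, ((genBStar κ hκ ε ψ : core ε) : Spinor) =
      (coordZStar κ hκ (coordZStar κ hκ ψ.1.1), coordZStar κ hκ (coordZStar κ hκ ψ.1.2)) :=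
    fun _ => rfl
  have hD : ∀ ψ, ((dirac ε ψ : core ε) : Spinor) = (delZ ψ.1.2, delZStar ψ.1.1) := fun _ => rfl
  have hγ : ∀ ψ, ((chirality ε ψ : core ε) : Spinor) = (ψ.1.1, -ψ.1.2) := fun _ => rfl
  have hDA : ∀ ψ, ((⁅dirac ε, genA κ hκ ε⁆ ψ : core ε) : Spinor) =
      (coordZStar κ hκ ψ.1.2, coordZ κ hκ ψ.1.1) := fun ψ => by
    simp [Ring.lie_def, hA, hD, delZ_coordZ, delZ_coordZStar, delZStar_coordZ,
      delZStar_coordZStar]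
  have hDB : ∀ ψ, ((⁅dirac ε, genB κ hκ ε⁆ ψ : core ε) : Spinor) =
      ((2 : ℂ) • coordZ κ hκ ψ.1.2, 0) := fun ψ => by
    simp [Ring.lie_def, hB, hD, delZ_coordZ, delZStar_coordZ]
    module
  have hDBs : ∀ ψ, ((⁅dirac ε, genBStar κ hκ ε⁆ ψ : core ε) : Spinor) =
      (0, (2 : ℂ) • coordZStar κ hκ ψ.1.1) := fun ψ => by
    simp [Ring.lie_def, hBs, hD, delZ_coordZStar, delZStar_coordZStar]
    module
  -- Rewriting with `coordZStar_coordZ` moves every `z⋆` to the right of every `z`. In this normal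
  -- order only coefficients remain to be compared.
  refine LinearMap.ext fun ψ => Subtype.ext (Prod.ext ?_ ?_) <;>
  · simp only [Module.End.mul_apply, LinearMap.add_apply, LinearMap.sub_apply,
      LinearMap.neg_apply, LinearMap.smul_apply, Submodule.coe_add, Submodule.coe_sub,
      Submodule.coe_neg, Submodule.coe_smul, Prod.fst_add, Prod.snd_add, Prod.fst_sub,
      Prod.snd_sub, Prod.fst_neg, Prod.snd_neg, Prod.smul_fst, Prod.smul_snd,
      hA, hB, hBs, hDA, hDB, hDBs, hγ, coordZStar_coordZ, map_add, map_smul, map_zero]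
    module

/-! ### Density of the Schwartz spinors. -/

theorem rhoL2_toHilbert (ψ : Spinor) : rhoL2 (toHilbert ψ) = toHilbert (rho ψ) := by
  have h : ∀ f : 𝓢(ℂ, ℂ), sigmaL2 (SchwartzMap.toLpCLM ℂ ℂ 2 MeasureTheory.volume f) =
      SchwartzMap.toLpCLM ℂ ℂ 2 MeasureTheory.volume (sigma f) := fun f => rfl
  refine (WithLp.linearEquiv 2 ℂ (L2 × L2)).injective (Prod.ext (h ψ.1) ?_)
  exact (congrArg Neg.neg (h ψ.2)).trans (map_neg _ _).symm

theorem continuous_rhoL2 : Continuous rhoL2 := by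
  have hs : Continuous sigmaL2 := (MeasureTheory.Lp.compMeasurePreservingₗᵢ ℂ Neg.neg
    (MeasureTheory.Measure.measurePreserving_neg MeasureTheory.volume)).continuous
  have h : Continuous fun x : L2 × L2 => (sigmaL2 x.1, -sigmaL2 x.2) := by fun_prop
  exact (WithLp.prod_continuous_toLp 2 L2 L2).comp (h.comp (WithLp.prod_continuous_ofLp 2 L2 L2))

theorem rho_rho (ψ : Spinor) : rho (rho ψ) = ψ := by
  refine Prod.ext ?_ ?_ <;> ext w <;> simp [rho, sigma]

/-- Schwartz functions are dense in `L²`, and the Hilbert norm on pairs induces the product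
topology. -/
theorem denseRange_toHilbert : DenseRange toHilbert := by
  have h := SchwartzMap.denseRange_toLpCLM (E := ℂ) (F := ℂ)
    (μ := (MeasureTheory.volume : MeasureTheory.Measure ℂ)) (p := 2) (by norm_num)
  exact (WithLp.homeomorphProd 2 L2 L2).symm.surjective.denseRange.comp (h.prodMap h)
    (WithLp.prod_continuous_toLp 2 L2 L2)

/-- The Schwartz spinors of the Moyal cone are dense in its Hilbert space. -/
theorem topologicalClosure_map_core (ε : ℂ) (hε : ε = 1 ∨ ε = -1) :
    ((core ε).map toHilbert).topologicalClosure = hilbert ε := by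
  have hε2 : ε * ε = 1 := by rcases hε with rfl | rfl <;> norm_num
  apply le_antisymm
  · apply Submodule.topologicalClosure_minimal
    · rintro _ ⟨ψ, hψ, rfl⟩
      rw [SetLike.mem_coe, core, Module.End.mem_eigenspace_iff] at hψ
      rw [hilbert, Module.End.mem_eigenspace_iff, rhoL2_toHilbert, hψ, map_smul]
    · have : (hilbert ε : Set HilbertPlane) = {x | rhoL2 x = ε • x} := by
        ext x
        exact Module.End.mem_eigenspace_iff
      rw [this]
      exact isClosed_eq continuous_rhoL2 (continuous_const_smul ε)
  · intro x hx
    rw [hilbert, Module.End.mem_eigenspace_iff] at hx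
    -- Approximants of `x` by arbitrary Schwartz spinors are averaged to land in the eigenspace;
    -- since `x` is fixed by the averaging, they still converge to it.
    have hP : Continuous fun y : HilbertPlane => (1 / 2 : ℂ) • (y + ε • rhoL2 y) := by
      have := continuous_rhoL2
      fun_prop
    have hPx : (1 / 2 : ℂ) • (x + ε • rhoL2 x) = x := by
      rw [hx, smul_smul, hε2]
      module
    rw [← hPx]
    refine map_mem_closure (f := fun y => (1 / 2 : ℂ) • (y + ε • rhoL2 y)) hP (denseRange_toHilbert x) ?_
    rintro _ ⟨ψ, rfl⟩
    refine ⟨(1 / 2 : ℂ) • (ψ + ε • rho ψ), ?_, ?_⟩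
    -- Since `ρ² = 1` and `ε² = 1`, both `ρ` and multiplication by `ε` send `ψ + ε ρψ` to `ρψ + εψ`.
    · rw [SetLike.mem_coe, core, Module.End.mem_eigenspace_iff, map_smul, map_add, map_smul,
        rho_rho, smul_comm ε, smul_add ε, smul_smul ε, hε2, one_smul, add_comm]
    · simp [rhoL2_toHilbert]

end MoyalCone

theorem lemma4p3 (κ : ℝ) (hκ : κ ≠ 0) (ε : ℂ) (hε : ε = 1 ∨ ε = -1) :
    ((core ε).map toHilbert).topologicalClosure = hilbert ε ∧
      -(⁅dirac ε, genBStar κ hκ ε⁆ * genA κ hκ ε * ⁅dirac ε, genB κ hκ ε⁆)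
        - (2 : ℂ) • (genA κ hκ ε * ⁅dirac ε, genB κ hκ ε⁆ * ⁅dirac ε, genBStar κ hκ ε⁆)
        + (3 / 2 : ℂ) • (genA κ hκ ε * ⁅dirac ε, genBStar κ hκ ε⁆ * ⁅dirac ε, genB κ hκ ε⁆)
        + (3 : ℂ) • (genB κ hκ ε * ⁅dirac ε, genA κ hκ ε⁆ * ⁅dirac ε, genBStar κ hκ ε⁆)
        - genB κ hκ ε * ⁅dirac ε, genBStar κ hκ ε⁆ * ⁅dirac ε, genA κ hκ ε⁆
        + genBStar κ hκ ε * ⁅dirac ε, genB κ hκ ε⁆ * ⁅dirac ε, genA κ hκ ε⁆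
        = (4 * (κ : ℂ) ^ 2) • chirality ε :=
  ⟨topologicalClosure_map_core ε hε, orientation_identity κ hκ ε⟩
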